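/- Let $(\mathcal{C},\mathbb{E},\mathfrak{s})$ be an extriangulated category (in the sense of Nakaoka and Palu) satisfying condition (WIC): whenever $gf$ is an inflation so is $f$, and whenever $gf$ is a deflation so is $g$. Definitions. An object $P$ is *projective* if for every $\mathbb{E}$-triangle $A\to B\to C\dashrightarrow$ the sequence $0\to\mathcal{C}(P,A)\to\mathcal{C}(P,B)\to\mathcal{C}(P,C)\to 0$ of abelian groups is exact; $\mathcal{P}(\mathcal{C})$ is the class of projective objects. An unbounded complex $\mathbf{X}=(\cdots\to X_1\xrightarrow{d_1}X_0\xrightarrow{d_0}X_{-1}\to\cdots)$ is *exact* if there are $\mathbb{E}$-triangles $K_{n+1}\xrightarrow{g_n}X_n\xrightarrow{f_n}K_n\dashrightarrow$ with $d_n=g_{n-1}f_n$ for all $n\in\mathbb{Z}$. For a class $\mathcal{W}$ of objects, it is $\mathcal{C}(-,\mathcal{W})$-*exact* if these $\mathbb{E}$-triangles can be chosen such that, for all $n$ and all $W\in\mathcal{W}$, the sequence $0\to\mathcal{C}(K_n,W)\to\mathcal{C}(X_n,W)\to\mathcal{C}(K_{n+1},W)\to 0$ is exact; $\mathcal{C}(\mathcal{W},-)$-*exact*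 is defined dually. A *complete projective resolution* is an unbounded complex of projective objects that is both $\mathcal{C}(-,\mathcal{P}(\mathcal{C}))$-exact and $\mathcal{C}(\mathcal{P}(\mathcal{C}),-)$-exact. An object is *Gorenstein projective* if it is one of the objects $K_n$ in a family of $\mathcal{C}(-,\mathcal{P}(\mathcal{C}))$-exact $\mathbb{E}$-triangles as above of a complete projective resolution; $\mathcal{GP}(\mathcal{C})$ is the class of these objects. For $n\ge 1$, an *exact complex* $0\to N\to X_{n-1}\xrightarrow{d_{n-1}}\cdots\xrightarrow{d_1}X_0\to M\to 0$ is one obtained by splicing $\mathbb{E}$-triangles $K_{i+1}\xrightarrow{g_i}X_i\xrightarrow{f_i}K_i\dashrightarrow$ ($0\le i<n$) with $K_0=M$, $K_n=N$ and $d_i=g_{i-1}f_i$ ($1\le i<n$). If such a complex exists with all $X_i\in\mathcal{GP}(\mathcal{C})$, then $N$ is a *Gorenstein $n$-syzygy object of $M$*; if one exists with all $X_i\in\mathcal{P}(\mathcal{C})$, then $N$ is an *$n$-syzygy object of $M$*. Theorem. Let $n$ be a positive integer and let $N$ be an object of $\mathcal{C}$. Then the following are equivalent. (1) There is an object $M\in\mathcal{C}$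 such that $N$ is a Gorenstein $n$-syzygy object of $M$. (2) There is a deflation $L\to G$ in $\mathcal{C}$ such that $N$ is an $n$-syzygy object of $L$ and $G\in\mathcal{GP}(\mathcal{C})$. -/

import Mathlib

open CategoryTheory CategoryTheory.Limits Opposite

universe w v u

/-- A sequence `A ⟶ B ⟶ Z` with fixed end terms. -/
structure ThreeTermSeq {C : Type u} [Category.{v} C] (A Z : C) where
  B : C
  x : A ⟶ B
  y : B ⟶ Z

/-- Two sequences with the same end terms are equivalent if there is an isomorphism between the
middle terms compatible with the maps. -/
instance ThreeTermSeq.setoid {C : Type u} [Category.{v} C] (A Z : C) :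
    Setoid (ThreeTermSeq A Z) where
  r S S' := ∃ b : S.B ≅ S'.B, S.x ≫ b.hom = S'.x ∧ b.hom ≫ S'.y = S.y
  iseqv :=
    { refl := fun S => ⟨Iso.refl _, by simp, by simp⟩
      symm := by
        rintro S S' ⟨b, h₁, h₂⟩
        exact ⟨b.symm, by simp [← h₁], by simp [← h₂]⟩
      trans := by
        rintro S S' S'' ⟨b, h₁, h₂⟩ ⟨b', h₁', h₂'⟩
        exact ⟨b ≪≫ b', by simp [← h₁', ← h₁], by simp [← h₂, ← h₂']⟩ }

/-- An additive bifunctor `E : Cᵒᵖ × C ⥤ Ab` together with a correspondence `s` that assigns to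
every extension `δ ∈ E(Z, A)` an equivalence class of sequences `A ⟶ B ⟶ Z`. -/
structure ExtensionData (C : Type u) [Category.{v} C] [Preadditive C] where
  E : Cᵒᵖ ⥤ C ⥤ AddCommGrpCat.{w}
  additive_left : E.Additive
  additive_right : ∀ Z : Cᵒᵖ, (E.obj Z).Additive
  s : ∀ {A Z : C}, (E.obj (op Z)).obj A → Quotient (ThreeTermSeq.setoid A Z)

namespace ExtensionData

variable {C : Type u} [Category.{v} C] [Preadditive C] (T : ExtensionData.{w} C)

/-- The group `E(Z, A)` of extensions of `Z` by `A`. -/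
abbrev Ext (Z A : C) : Type w := (T.E.obj (op Z)).obj A

/-- `a_* δ`. -/
def push {Z A A' : C} (a : A ⟶ A') (δ : T.Ext Z A) : T.Ext Z A' :=
  ((T.E.obj (op Z)).map a).hom δ

/-- `c^* δ`. -/
def pull {Z Z' A : C} (c : Z' ⟶ Z) (δ : T.Ext Z A) : T.Ext Z' A :=
  ((T.E.map c.op).app A).hom δ

/-- The sequence `A ⟶ B ⟶ Z` realizes `δ`, i.e. `A ⟶ B ⟶ Z` together with `δ` is an
`E`-triangle. -/
def Realizes {A B Z : C} (x : A ⟶ B) (y : B ⟶ Z) (δ : T.Ext Z A) : Prop :=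
  T.s δ = Quotient.mk _ ⟨B, x, y⟩

/-- The direct sum `δ ⊕ δ' ∈ E(Z ⊞ Z', A ⊞ A')`, that is, the extension with components
`(δ, 0, 0, δ')`. -/
noncomputable def extSum [HasBinaryBiproducts C] {Z A Z' A' : C} (δ : T.Ext Z A)
    (δ' : T.Ext Z' A') : T.Ext (Z ⊞ Z') (A ⊞ A') :=
  T.push biprod.inl (T.pull biprod.fst δ) + T.push biprod.inr (T.pull biprod.snd δ')

end ExtensionData

/-- Extriangulated categories `(C, E, s)` in the sense of Nakaoka and Palu. -/
structure ExtriangulatedStructure (C : Type u) [Category.{v} C] [Preadditive C]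
    [HasZeroObject C] [HasBinaryBiproducts C] extends ExtensionData.{w} C where
  /-- `s` is a realization of `E`. -/
  realization : ∀ {A B Z A' B' Z' : C} {x : A ⟶ B} {y : B ⟶ Z} {δ : toExtensionData.Ext Z A}
    {x' : A' ⟶ B'} {y' : B' ⟶ Z'} {δ' : toExtensionData.Ext Z' A'},
    toExtensionData.Realizes x y δ → toExtensionData.Realizes x' y' δ' →
    ∀ (a : A ⟶ A') (c : Z ⟶ Z'), toExtensionData.push a δ = toExtensionData.pull c δ' →
      ∃ b : B ⟶ B', x ≫ b = a ≫ x' ∧ b ≫ y' = y ≫ c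
  /-- The realization is additive: `s(0) = 0`. -/
  realizes_zero : ∀ A Z : C,
    toExtensionData.Realizes (biprod.inl : A ⟶ A ⊞ Z) (biprod.snd : A ⊞ Z ⟶ Z) 0
  /-- The realization is additive: `s(δ ⊕ δ') = s(δ) ⊕ s(δ')`. -/
  realizes_sum : ∀ {A B Z A' B' Z' : C} {x : A ⟶ B} {y : B ⟶ Z} {δ : toExtensionData.Ext Z A}
    {x' : A' ⟶ B'} {y' : B' ⟶ Z'} {δ' : toExtensionData.Ext Z' A'},
    toExtensionData.Realizes x y δ → toExtensionData.Realizes x' y' δ' →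
      toExtensionData.Realizes (biprod.map x x') (biprod.map y y')
        (toExtensionData.extSum δ δ')
  et3 : ∀ {A B Z A' B' Z' : C} {x : A ⟶ B} {y : B ⟶ Z} {δ : toExtensionData.Ext Z A}
    {x' : A' ⟶ B'} {y' : B' ⟶ Z'} {δ' : toExtensionData.Ext Z' A'},
    toExtensionData.Realizes x y δ → toExtensionData.Realizes x' y' δ' →
    ∀ (a : A ⟶ A') (b : B ⟶ B'), x ≫ b = a ≫ x' →
      ∃ c : Z ⟶ Z', toExtensionData.push a δ = toExtensionData.pull c δ' ∧ b ≫ y' = y ≫ c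
  et3_op : ∀ {A B Z A' B' Z' : C} {x : A ⟶ B} {y : B ⟶ Z} {δ : toExtensionData.Ext Z A}
    {x' : A' ⟶ B'} {y' : B' ⟶ Z'} {δ' : toExtensionData.Ext Z' A'},
    toExtensionData.Realizes x y δ → toExtensionData.Realizes x' y' δ' →
    ∀ (b : B ⟶ B') (c : Z ⟶ Z'), b ≫ y' = y ≫ c →
      ∃ a : A ⟶ A', toExtensionData.push a δ = toExtensionData.pull c δ' ∧ x ≫ b = a ≫ x'
  et4 : ∀ {A B Z D F : C} {f : A ⟶ B} {f' : B ⟶ D} {δ : toExtensionData.Ext D A}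
    {g : B ⟶ Z} {g' : Z ⟶ F} {δ' : toExtensionData.Ext F B},
    toExtensionData.Realizes f f' δ → toExtensionData.Realizes g g' δ' →
    ∃ (Y : C) (h : A ⟶ Z) (h' : Z ⟶ Y) (d : D ⟶ Y) (e : Y ⟶ F)
      (δ'' : toExtensionData.Ext Y A),
      toExtensionData.Realizes h h' δ'' ∧
      f ≫ g = h ∧ f' ≫ d = g ≫ h' ∧ h' ≫ e = g' ∧
      toExtensionData.Realizes d e (toExtensionData.push f' δ') ∧
      toExtensionData.pull d δ'' = δ ∧
      toExtensionData.push f δ'' = toExtensionData.pull e δ'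
  et4_op : ∀ {A B Z D F : C} {f' : D ⟶ B} {f : B ⟶ A} {δ : toExtensionData.Ext A D}
    {g' : F ⟶ Z} {g : Z ⟶ B} {δ' : toExtensionData.Ext B F},
    toExtensionData.Realizes f' f δ → toExtensionData.Realizes g' g δ' →
    ∃ (Y : C) (h' : Y ⟶ Z) (h : Z ⟶ A) (e : F ⟶ Y) (d : Y ⟶ D)
      (δ'' : toExtensionData.Ext A Y),
      toExtensionData.Realizes h' h δ'' ∧
      g ≫ f = h ∧ d ≫ f' = h' ≫ g ∧ e ≫ h' = g' ∧
      toExtensionData.Realizes e d (toExtensionData.pull f' δ') ∧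
      toExtensionData.push d δ'' = δ ∧
      toExtensionData.pull f δ'' = toExtensionData.push e δ'

namespace ExtriangulatedStructure

variable {C : Type u} [Category.{v} C] [Preadditive C] [HasZeroObject C] [HasBinaryBiproducts C]
  (T : ExtriangulatedStructure.{w} C)

/-- `A ⟶ B ⟶ Z` is a conflation, i.e. it underlies an `E`-triangle. -/
def IsConflation {A B Z : C} (x : A ⟶ B) (y : B ⟶ Z) : Prop :=
  ∃ δ : T.Ext Z A, T.Realizes x y δ

def IsInflation {A B : C} (x : A ⟶ B) : Prop :=
  ∃ (Z : C) (y : B ⟶ Z), T.IsConflation x y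

def IsDeflation {B Z : C} (y : B ⟶ Z) : Prop :=
  ∃ (A : C) (x : A ⟶ B), T.IsConflation x y

/-- Condition (WIC). -/
def WIC : Prop :=
  (∀ {X Y Z : C} (f : X ⟶ Y) (g : Y ⟶ Z), T.IsInflation (f ≫ g) → T.IsInflation f) ∧
  (∀ {X Y Z : C} (f : X ⟶ Y) (g : Y ⟶ Z), T.IsDeflation (f ≫ g) → T.IsDeflation g)

end ExtriangulatedStructure

section HomExact

variable {C : Type u} [Category.{v} C] [Preadditive C]

/-- `0 ⟶ Hom(W, A) ⟶ Hom(W, B) ⟶ Hom(W, Z) ⟶ 0` is an exact sequence of abelian groups. -/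
def HomFromExact (W : C) {A B Z : C} (x : A ⟶ B) (y : B ⟶ Z) : Prop :=
  Function.Injective (fun h : W ⟶ A => h ≫ x) ∧
  Function.Exact (fun h : W ⟶ A => h ≫ x) (fun h : W ⟶ B => h ≫ y) ∧
  Function.Surjective (fun h : W ⟶ B => h ≫ y)

/-- `0 ⟶ Hom(Z, W) ⟶ Hom(B, W) ⟶ Hom(A, W) ⟶ 0` is an exact sequence of abelian groups. -/
def HomToExact (W : C) {A B Z : C} (x : A ⟶ B) (y : B ⟶ Z) : Prop :=
  Function.Injective (fun h : Z ⟶ W => y ≫ h) ∧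
  Function.Exact (fun h : Z ⟶ W => y ≫ h) (fun h : B ⟶ W => x ≫ h) ∧
  Function.Surjective (fun h : B ⟶ W => x ≫ h)

end HomExact

namespace ExtriangulatedStructure

variable {C : Type u} [Category.{v} C] [Preadditive C] [HasZeroObject C] [HasBinaryBiproducts C]
  (T : ExtriangulatedStructure.{w} C)

/-- Projective objects (with respect to all `E`-triangles). -/
def IsProjective : ObjectProperty C := fun P =>
  ∀ {A B Z : C} (x : A ⟶ B) (y : B ⟶ Z), T.IsConflation x y → HomFromExact P x y

/-- `E`-triangles `K (n + 1) ⟶ X n ⟶ K n` for all integers `n` that exhibit the unbounded complex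
`X` as an exact complex: the differential `X (n + 1) ⟶ X n` is the composite
`X (n + 1) ⟶ K (n + 1) ⟶ X n`. -/
structure ExactDecomposition (X : ChainComplex C ℤ) where
  K : ℤ → C
  g : ∀ n : ℤ, K (n + 1) ⟶ X.X n
  f : ∀ n : ℤ, X.X n ⟶ K n
  δ : ∀ n : ℤ, T.Ext (K n) (K (n + 1))
  realizes : ∀ n : ℤ, T.Realizes (g n) (f n) (δ n)
  d_eq : ∀ n : ℤ, X.d (n + 1) n = f (n + 1) ≫ g n

variable {T} in
/-- All the `E`-triangles of the decomposition are `C(-, W)`-exact. -/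
def ExactDecomposition.IsHomToExact {X : ChainComplex C ℤ} (D : T.ExactDecomposition X)
    (W : ObjectProperty C) : Prop :=
  ∀ V : C, W V → ∀ n : ℤ, HomToExact V (D.g n) (D.f n)

variable {T} in
/-- All the `E`-triangles of the decomposition are `C(W, -)`-exact. -/
def ExactDecomposition.IsHomFromExact {X : ChainComplex C ℤ} (D : T.ExactDecomposition X)
    (W : ObjectProperty C) : Prop :=
  ∀ V : C, W V → ∀ n : ℤ, HomFromExact V (D.g n) (D.f n)

/-- A complex is complete `W`-exact if it is both `C(-, W)`-exact and `C(W, -)`-exact. -/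
def IsCompleteExact (W : ObjectProperty C) (X : ChainComplex C ℤ) : Prop :=
  (∃ D : T.ExactDecomposition X, D.IsHomToExact W) ∧
  (∃ D : T.ExactDecomposition X, D.IsHomFromExact W)

/-- A complete projective resolution: a complex of projective objects which is complete exact with
respect to the class of projective objects. -/
def IsCompleteProjectiveResolution (X : ChainComplex C ℤ) : Prop :=
  (∀ n : ℤ, T.IsProjective (X.X n)) ∧ T.IsCompleteExact T.IsProjective X

/-- Gorenstein projective objects: the objects `K n` in the `C(-, 𝒫(C))`-exact `E`-triangles
`K (n + 1) ⟶ X n ⟶ K n` of a complete projective resolution `X`. -/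
def IsGorensteinProjective : ObjectProperty C := fun G =>
  ∃ X : ChainComplex C ℤ, T.IsCompleteProjectiveResolution X ∧
    ∃ D : T.ExactDecomposition X, D.IsHomToExact T.IsProjective ∧ ∃ n : ℤ, D.K n = G

/-- An exact complex `0 ⟶ N ⟶ X (n - 1) ⟶ ⋯ ⟶ X 1 ⟶ X 0 ⟶ M ⟶ 0`, given by its `E`-triangles
`K (i + 1) ⟶ X i ⟶ K i` for `0 ≤ i < n`, where `K 0 = M` and `K n = N`. -/
structure FiniteExactComplex (n : ℕ) (N M : C) where
  X : Fin n → C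
  K : Fin (n + 1) → C
  K_zero : K 0 = M
  K_last : K (Fin.last n) = N
  g : ∀ i : Fin n, K i.succ ⟶ X i
  f : ∀ i : Fin n, X i ⟶ K i.castSucc
  δ : ∀ i : Fin n, T.Ext (K i.castSucc) (K i.succ)
  realizes : ∀ i : Fin n, T.Realizes (g i) (f i) (δ i)
  /-- The differentials `X (i + 1) ⟶ X i`. -/
  d : ∀ (i : ℕ) (hi : i + 1 < n), X ⟨i + 1, hi⟩ ⟶ X ⟨i, by omega⟩
  d_eq : ∀ (i : ℕ) (hi : i + 1 < n), d i hi = f ⟨i + 1, hi⟩ ≫ g ⟨i, by omega⟩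

/-- `N` is a Gorenstein `n`-syzygy object of `M`. -/
def IsGorensteinSyzygy (n : ℕ) (N M : C) : Prop :=
  ∃ S : T.FiniteExactComplex n N M, ∀ i : Fin n, T.IsGorensteinProjective (S.X i)

/-- `N` is an `n`-syzygy object of `M`. -/
def IsSyzygy (n : ℕ) (N M : C) : Prop :=
  ∃ S : T.FiniteExactComplex n N M, ∀ i : Fin n, T.IsProjective (S.X i)

end ExtriangulatedStructure

open scoped ZeroObject

/-! Projective objects are Gorenstein projective, so (2) gives (1) with `M = L`. For (1) ⇒ (2),
induct on the length. Given `N ⟶ X ⟶ K` with `X` Gorenstein projective and `K` already a projective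
syzygy of some `L`, embed `X ⟶ P ⟶ G` with `P` projective and `G` Gorenstein projective. The
octahedral axiom gives `N ⟶ P ⟶ K'` and `K ⟶ K' ⟶ G`.

It remains to carry the projective resolution from `K` to `K'`
(`HasResolution.exists_of_hasConflation`); this yields `L ⟶ L' ⟶ G'`, whose second map is the
required deflation. The transport rests on pushouts of inflations (`HasConflation.exists_pushout`)
and on the vanishing of `E(G, P)` for `G` Gorenstein projective and `P` projective. -/

namespace ExtriangulatedStructure

variable {C : Type u} [Category.{v} C] [Preadditive C] [HasZeroObject C] [HasBinaryBiproducts C]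
  (T : ExtriangulatedStructure.{w} C)

/-! ### Extension classes and their realizations -/

section Extensions

variable {T}

@[simp]
lemma push_zero {Z A A' : C} (a : A ⟶ A') : T.push a (0 : T.Ext Z A) = 0 :=
  map_zero _

@[simp]
lemma pull_zero {Z Z' A : C} (c : Z' ⟶ Z) : T.pull c (0 : T.Ext Z A) = 0 :=
  map_zero _

lemma pull_add {Z Z' A : C} (c : Z' ⟶ Z) (δ δ' : T.Ext Z A) :
    T.pull c (δ + δ') = T.pull c δ + T.pull c δ' :=
  map_add _ _ _

@[simp]
lemma pull_id {Z A : C} (δ : T.Ext Z A) : T.pull (𝟙 Z) δ = δ := by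
  simp [ExtensionData.pull]

lemma pull_comp {Z Z' Z'' A : C} (c : Z'' ⟶ Z') (c' : Z' ⟶ Z) (δ : T.Ext Z A) :
    T.pull (c ≫ c') δ = T.pull c (T.pull c' δ) := by
  simp [ExtensionData.pull]

@[simp]
lemma zero_pull {Z Z' A : C} (δ : T.Ext Z A) : T.pull (0 : Z' ⟶ Z) δ = 0 := by
  have := T.additive_left
  simp [ExtensionData.pull]

@[simp]
lemma push_id {Z A : C} (δ : T.Ext Z A) : T.push (𝟙 A) δ = δ := by
  simp [ExtensionData.push]

lemma push_comp {Z A A' A'' : C} (a : A ⟶ A') (a' : A' ⟶ A'') (δ : T.Ext Z A) :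
    T.push (a ≫ a') δ = T.push a' (T.push a δ) := by
  simp [ExtensionData.push]

lemma exists_realizes {Z A : C} (δ : T.Ext Z A) :
    ∃ (B : C) (x : A ⟶ B) (y : B ⟶ Z), T.Realizes x y δ := by
  obtain ⟨S, hS⟩ := Quotient.exists_rep (T.s δ)
  exact ⟨S.B, S.x, S.y, hS.symm⟩

lemma _root_.ExtensionData.Realizes.exists_iso {A B B' Z : C} {x : A ⟶ B} {y : B ⟶ Z}
    {x' : A ⟶ B'} {y' : B' ⟶ Z} {δ : T.Ext Z A} (h : T.Realizes x y δ)
    (h' : T.Realizes x' y' δ) : ∃ b : B ≅ B', x ≫ b.hom = x' ∧ b.hom ≫ y' = y :=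
  Quotient.exact (Eq.trans (Eq.symm h) h')

lemma _root_.ExtensionData.Realizes.of_iso {A B B' Z : C} {x : A ⟶ B} {y : B ⟶ Z}
    {δ : T.Ext Z A} (h : T.Realizes x y δ) (b : B ≅ B') :
    T.Realizes (x ≫ b.hom) (b.inv ≫ y) δ :=
  Eq.trans h (Quotient.sound ⟨b, rfl, by simp⟩)

variable (T) in
lemma realizes_id_left (A : C) : T.Realizes (𝟙 A) (0 : A ⟶ 0) 0 := by
  let b : A ⊞ (0 : C) ≅ A :=
    { hom := biprod.fst
      inv := biprod.inl
      hom_inv_id := by ext; simp }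
  convert (T.realizes_zero A 0).of_iso b using 1
  · simp [b]
  · simp [b]

variable (T) in
lemma realizes_id_right (A : C) : T.Realizes (0 : (0 : C) ⟶ A) (𝟙 A) 0 := by
  let b : (0 : C) ⊞ A ≅ A :=
    { hom := biprod.snd
      inv := biprod.inr
      hom_inv_id := by ext; simp }
  convert (T.realizes_zero 0 A).of_iso b using 1
  · simp [b]
  · simp [b]

variable (T) in
lemma realizes_inr_fst (A Z : C) :
    T.Realizes (biprod.inr : A ⟶ Z ⊞ A) (biprod.fst : Z ⊞ A ⟶ Z) 0 := by
  convert (T.realizes_zero A Z).of_iso (biprod.braiding A Z) using 1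
  · ext <;> simp
  · simp

lemma _root_.ExtensionData.Realizes.push_eq_zero {A B Z : C} {x : A ⟶ B} {y : B ⟶ Z}
    {δ : T.Ext Z A} (h : T.Realizes x y δ) : T.push x δ = 0 := by
  obtain ⟨c, hc, -⟩ := T.et3 h (T.realizes_id_left B) x (𝟙 B) (by simp)
  simpa using hc

/-- Comparison with `0 ⟶ W ⟶ W` by `et3`; this makes `y` a weak cokernel of `x`. -/
lemma _root_.ExtensionData.Realizes.exists_desc {A B Z W : C} {x : A ⟶ B} {y : B ⟶ Z}
    {δ : T.Ext Z A} (h : T.Realizes x y δ) (u : B ⟶ W) (hu : x ≫ u = 0) :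
    ∃ v : Z ⟶ W, u = y ≫ v := by
  obtain ⟨c, -, hc⟩ := T.et3 h (T.realizes_id_right W) 0 u (by simpa using hu)
  exact ⟨c, by simpa using hc⟩

/-- An endomorphism of the middle term of an `E`-triangle that is compatible with the identities
of the end terms is invertible. -/
lemma _root_.ExtensionData.Realizes.isIso_of_end {A B Z : C} {x : A ⟶ B} {y : B ⟶ Z}
    {δ : T.Ext Z A} (h : T.Realizes x y δ) (b : B ⟶ B) (hx : x ≫ b = x) (hy : b ≫ y = y) :
    IsIso b := by
  obtain ⟨v, hv⟩ := h.exists_desc (b - 𝟙 B) (by simp [hx])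
  -- `b - 𝟙 B` is killed by `y` and factors through `y`, so it squares to zero and `𝟙 B` minus it
  -- inverts `b`.
  have hsq : (b - 𝟙 B) ≫ (b - 𝟙 B) = 0 := by
    nth_rw 2 [hv]
    simp [reassoc_of% hy]
  have hb : b = 𝟙 B + (b - 𝟙 B) := by abel
  generalize b - 𝟙 B = u at hsq hb
  subst hb
  exact ⟨𝟙 B - u, by simp [hsq], by simp [hsq]⟩

end Extensions

/-! ### Constructions with conflations -/

section Conflations

/-- There is a conflation with terms `A`, `B`, `Z`. -/
def HasConflation (A B Z : C) : Prop :=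
  ∃ (x : A ⟶ B) (y : B ⟶ Z), T.IsConflation x y

variable {T}

lemma _root_.ExtensionData.Realizes.hasConflation {A B Z : C} {x : A ⟶ B} {y : B ⟶ Z}
    {δ : T.Ext Z A} (h : T.Realizes x y δ) : T.HasConflation A B Z :=
  ⟨x, y, δ, h⟩

/-- Realizations are only given up to isomorphism of the middle term, so the end term is changed by
pushing the class along `e`. The comparison maps `b`, `b'` have invertible composites by
`isIso_of_end`, hence the middle terms agree. -/
lemma HasConflation.of_iso_left {A A' B Z : C} (h : T.HasConflation A B Z) (e : A ≅ A') :
    T.HasConflation A' B Z := by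
  obtain ⟨x, y, δ, h⟩ := h
  obtain ⟨B', x', y', h'⟩ := exists_realizes (T.push e.hom δ)
  obtain ⟨b, hb₁, hb₂⟩ := T.realization h h' e.hom (𝟙 Z) (by simp)
  obtain ⟨b', hb₁', hb₂'⟩ := T.realization h' h e.inv (𝟙 Z) (by simp [← push_comp])
  have h₁ : IsIso (b ≫ b') :=
    h.isIso_of_end _ (by rw [reassoc_of% hb₁, hb₁']; simp) (by simp [hb₂', hb₂])
  have h₂ : IsIso (b' ≫ b) :=
    h'.isIso_of_end _ (by rw [reassoc_of% hb₁', hb₁]; simp) (by simp [hb₂', hb₂])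
  have : IsSplitMono b := ⟨⟨⟨b' ≫ inv (b ≫ b'), by rw [← Category.assoc, IsIso.hom_inv_id]⟩⟩⟩
  have : IsSplitEpi b := ⟨⟨⟨inv (b' ≫ b) ≫ b', by rw [Category.assoc, IsIso.inv_hom_id]⟩⟩⟩
  have : IsIso b := isIso_of_epi_of_isSplitMono b
  exact (h'.of_iso (asIso b).symm).hasConflation

/-- By `et4_op`, the kernel of `M ⟶ D ⟶ W` realizes the restriction of `μ` to `Z`, hence is
isomorphic to `B`. -/
lemma HasConflation.of_pull {A B M Z D W : C} {x : A ⟶ B} {y : B ⟶ Z} {i : Z ⟶ D} {p : D ⟶ W}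
    {δ : T.Ext W Z} {x' : A ⟶ M} {y' : M ⟶ D} {μ : T.Ext D A} (hi : T.Realizes i p δ)
    (h' : T.Realizes x' y' μ) (h : T.Realizes x y (T.pull i μ)) : T.HasConflation B M W := by
  obtain ⟨Y, k, _, _, _, _, hk, -, -, -, hY, -, -⟩ := T.et4_op hi h'
  obtain ⟨b, -, -⟩ := hY.exists_iso h
  exact hk.hasConflation.of_iso_left b

/-- The pushout of two inflations with the same source. -/
lemma HasConflation.exists_pushout {A B₁ Z₁ B₂ Z₂ : C} (h₁ : T.HasConflation A B₁ Z₁)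
    (h₂ : T.HasConflation A B₂ Z₂) :
    ∃ M : C, T.HasConflation B₁ M Z₂ ∧ T.HasConflation B₂ M Z₁ := by
  obtain ⟨x₁, y₁, δ₁, h₁⟩ := h₁
  obtain ⟨x₂, y₂, δ₂, h₂⟩ := h₂
  -- This class on `Z₁ ⊞ Z₂` restricts to `δ₁` and `δ₂` on the summands; its middle term serves as
  -- the pushout.
  obtain ⟨M, x, y, h⟩ := exists_realizes
    (T.pull (biprod.fst : Z₁ ⊞ Z₂ ⟶ Z₁) δ₁ + T.pull (biprod.snd : Z₁ ⊞ Z₂ ⟶ Z₂) δ₂)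
  refine ⟨M, .of_pull (T.realizes_zero Z₁ Z₂) h (x := x₁) (y := y₁) ?_,
    .of_pull (T.realizes_inr_fst Z₂ Z₁) h (x := x₂) (y := y₂) ?_⟩
  · simpa [pull_add, ← pull_comp] using h₁
  · simpa [pull_add, ← pull_comp] using h₂

/-- The cokernel of a composite of two inflations. -/
lemma HasConflation.exists_comp {A B D M F : C} (h₁ : T.HasConflation A B D)
    (h₂ : T.HasConflation B M F) :
    ∃ Y : C, T.HasConflation A M Y ∧ T.HasConflation D Y F := by
  obtain ⟨x₁, y₁, δ₁, h₁⟩ := h₁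
  obtain ⟨x₂, y₂, δ₂, h₂⟩ := h₂
  obtain ⟨Y, _, _, _, _, _, hY, -, -, -, hY', -, -⟩ := T.et4 h₁ h₂
  exact ⟨Y, hY.hasConflation, hY'.hasConflation⟩

lemma HasConflation.nonempty_iso_biprod {A B Z : C} (h : T.HasConflation A B Z)
    (h₀ : ∀ δ : T.Ext Z A, δ = 0) : Nonempty (A ⊞ Z ≅ B) := by
  obtain ⟨x, y, δ, h⟩ := h
  obtain rfl := h₀ δ
  obtain ⟨b, -, -⟩ := (T.realizes_zero A Z).exists_iso h
  exact ⟨b⟩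

end Conflations

/-! ### Projective and Gorenstein projective objects -/

section Projectives

variable {T}

lemma IsProjective.of_iso {P Q : C} (hP : T.IsProjective P) (e : P ≅ Q) : T.IsProjective Q := by
  intro A B Z x y h
  obtain ⟨h₁, h₂, h₃⟩ := hP x y h
  refine ⟨fun a a' haa' => ?_, fun b => ⟨fun hb => ?_, ?_⟩, fun c => ?_⟩
  · have := @h₁ (e.hom ≫ a) (e.hom ≫ a') (by simpa using haa')
    simpa using this
  · obtain ⟨a, ha⟩ := (h₂ (e.hom ≫ b)).1 (by simpa using hb)
    exact ⟨e.inv ≫ a, by simp only [Category.assoc] at ha ⊢; simp [ha]⟩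
  · rintro ⟨a, rfl⟩
    have := (h₂ (e.hom ≫ a ≫ x)).2 ⟨e.hom ≫ a, by simp⟩
    simpa using this
  · obtain ⟨b, hb⟩ := h₃ (e.hom ≫ c)
    exact ⟨e.inv ≫ b, by simp only [Category.assoc] at hb ⊢; simp [hb]⟩

lemma IsProjective.biprod {P Q : C} (hP : T.IsProjective P) (hQ : T.IsProjective Q) :
    T.IsProjective (P ⊞ Q) := by
  intro A B Z x y h
  obtain ⟨h₁, h₂, h₃⟩ := hP x y h
  obtain ⟨k₁, k₂, k₃⟩ := hQ x y h
  refine ⟨fun a a' haa' => ?_, fun b => ⟨fun hb => ?_, ?_⟩, fun c => ?_⟩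
  · dsimp only at haa'
    exact biprod.hom_ext' _ _ (h₁ (by simp [haa'])) (k₁ (by simp [haa']))
  · dsimp only at hb
    obtain ⟨a, ha⟩ := (h₂ (biprod.inl ≫ b)).1 (by simp [hb])
    obtain ⟨a', ha'⟩ := (k₂ (biprod.inr ≫ b)).1 (by simp [hb])
    exact ⟨biprod.desc a a', biprod.hom_ext' _ _ (by simpa using ha) (by simpa using ha')⟩
  · rintro ⟨a, rfl⟩
    refine biprod.hom_ext' _ _ ?_ ?_
    · simpa using (h₂ (biprod.inl ≫ a ≫ x)).2 ⟨biprod.inl ≫ a, by simp⟩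
    · simpa using (k₂ (biprod.inr ≫ a ≫ x)).2 ⟨biprod.inr ≫ a, by simp⟩
  · obtain ⟨b, hb⟩ := h₃ (biprod.inl ≫ c)
    obtain ⟨b', hb'⟩ := k₃ (biprod.inr ≫ c)
    exact ⟨biprod.desc b b', biprod.hom_ext' _ _ (by simpa using hb) (by simpa using hb')⟩

/-- The deflation splits; by `et3_op` a section exhibits `δ` as the pushforward of the zero class of
`0 ⟶ P ⟶ P`. -/
lemma IsProjective.ext_eq_zero {P A : C} (hP : T.IsProjective P) (δ : T.Ext P A) : δ = 0 := by
  obtain ⟨B, x, y, h⟩ := exists_realizes δ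
  obtain ⟨s, hs⟩ := (hP x y ⟨δ, h⟩).2.2 (𝟙 P)
  obtain ⟨a, ha, -⟩ := T.et3_op (T.realizes_id_right P) h s (𝟙 P) (by simpa using hs)
  simpa using ha.symm

lemma IsProjective.of_hasConflation {P M Q : C} (hP : T.IsProjective P) (hQ : T.IsProjective Q)
    (h : T.HasConflation P M Q) : T.IsProjective M :=
  IsProjective.of_iso (IsProjective.biprod hP hQ) (h.nonempty_iso_biprod hQ.ext_eq_zero).some

/-- A projective object is a term of the periodic complete projective resolution with
differentials `P ⊞ P ⟶ P ⟶ P ⊞ P`. -/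
lemma IsProjective.isGorensteinProjective {P : C} (hP : T.IsProjective P) :
    T.IsGorensteinProjective P := by
  let X : ChainComplex C ℤ := ChainComplex.of (fun _ => P ⊞ P)
    (fun _ => biprod.snd ≫ biprod.inl) (by simp)
  let D : T.ExactDecomposition X :=
    { K := fun _ => P
      g := fun _ => biprod.inl
      f := fun _ => biprod.snd
      δ := fun _ => 0
      realizes := fun _ => T.realizes_zero P P
      d_eq := fun n => by simp [X] }
  have hD : D.IsHomToExact T.IsProjective := by
    intro V _ n
    refine ⟨fun a a' haa' => ?_, fun b => ⟨fun hb => ?_, ?_⟩, fun c => ?_⟩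
    · have := congrArg (fun t : P ⊞ P ⟶ V => biprod.inr ≫ t) haa'
      simpa [D] using this
    · change biprod.inl ≫ b = 0 at hb
      exact ⟨biprod.inr ≫ b, biprod.hom_ext' _ _ (by simp [D, hb]) (by simp [D])⟩
    · rintro ⟨a, rfl⟩
      simp [D]
    · exact ⟨biprod.desc c 0, by simp [D]⟩
  exact ⟨X, ⟨fun n => hP.biprod hP, ⟨D, hD⟩, ⟨D, fun V hV n => hV _ _ ⟨_, D.realizes n⟩⟩⟩,
    D, hD, 0, rfl⟩

lemma IsGorensteinProjective.exists_hasConflation {G : C} (hG : T.IsGorensteinProjective G) :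
    ∃ P G' : C, T.IsProjective P ∧ T.IsGorensteinProjective G' ∧ T.HasConflation G P G' := by
  obtain ⟨X, hX, D, hD, n, rfl⟩ := hG
  obtain ⟨m, rfl⟩ : ∃ m, n = m + 1 := ⟨n - 1, by ring⟩
  exact ⟨X.X m, D.K m, hX.1 m, ⟨X, hX, D, hD, m, rfl⟩, (D.realizes m).hasConflation⟩

/-- Lifting `X n ⟶ G` to the middle term of `δ` writes `δ` as the pushforward of `D.δ n` along some
`a : K (n + 1) ⟶ P`. Since `P` is projective, `a` extends over `D.g n`, which already kills `D.δ n`.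
-/
lemma IsGorensteinProjective.ext_eq_zero {G P : C} (hG : T.IsGorensteinProjective G)
    (hP : T.IsProjective P) (δ : T.Ext G P) : δ = 0 := by
  obtain ⟨X, hX, D, hD, n, rfl⟩ := hG
  obtain ⟨B, x, y, h⟩ := exists_realizes δ
  obtain ⟨b, hb⟩ := (hX.1 n x y ⟨δ, h⟩).2.2 (D.f n)
  obtain ⟨a, ha, -⟩ := T.et3_op (D.realizes n) h b (𝟙 _) (by simpa using hb)
  obtain ⟨e, he⟩ := (hD P hP n).2.2 a
  rw [pull_id] at ha
  rw [← ha, ← he, push_comp, (D.realizes n).push_eq_zero, push_zero]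

end Projectives

/-! ### Transport of resolutions -/

section Syzygies

/-- `N` is an iterated syzygy object of `M` with respect to the class `W`, in terms of
conflations `K (i + 1) ⟶ X i ⟶ K i`. -/
def HasResolution (W : ObjectProperty C) (n : ℕ) (N M : C) : Prop :=
  ∃ X K : ℕ → C, K 0 = M ∧ K n = N ∧
    ∀ i < n, W (X i) ∧ T.HasConflation (K (i + 1)) (X i) (K i)

variable {T} {W : ObjectProperty C}

lemma hasResolution_iff {n : ℕ} {N M : C} :
    T.HasResolution W n N M ↔ ∃ S : T.FiniteExactComplex n N M, ∀ i, W (S.X i) := by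
  constructor
  · rintro ⟨X, K, h₀, hn, h⟩
    choose hW x y δ hδ using h
    exact ⟨{
      X := fun i => X i
      K := fun i => K i
      K_zero := h₀
      K_last := hn
      g := fun i => x i i.2
      f := fun i => y i i.2
      δ := fun i => δ i i.2
      realizes := fun i => hδ i i.2
      d := fun i hi => y (i + 1) hi ≫ x i (by omega)
      d_eq := fun i hi => rfl }, fun i => hW i i.2⟩
  · rintro ⟨S, hS⟩
    refine ⟨fun i => if h : i < n then S.X ⟨i, h⟩ else 0,
      fun i => if h : i < n + 1 then S.K ⟨i, h⟩ else 0, ?_, ?_, fun i hi => ?_⟩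
    · simpa using S.K_zero
    · simpa using! S.K_last
    · dsimp only
      rw [dif_pos hi, dif_pos (by omega), dif_pos (by omega)]
      exact ⟨hS _, (S.realizes ⟨i, hi⟩).hasConflation⟩

lemma hasResolution_zero_iff {N M : C} : T.HasResolution W 0 N M ↔ N = M :=
  ⟨fun ⟨_, _, h₀, hn, _⟩ => hn.symm.trans h₀,
    fun h => ⟨fun _ => N, fun _ => N, h, rfl, by simp⟩⟩

/-- The conflation is split off at the `N` end, so that inductions keep `M` fixed while `N` varies.
-/
lemma hasResolution_succ_iff {n : ℕ} {N M : C} :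
    T.HasResolution W (n + 1) N M ↔
      ∃ X K : C, W X ∧ T.HasConflation N X K ∧ T.HasResolution W n K M := by
  constructor
  · rintro ⟨X, K, h₀, rfl, h⟩
    exact ⟨X n, K n, (h n (by omega)).1, (h n (by omega)).2, X, K, h₀, rfl,
      fun i hi => h i (by omega)⟩
  · rintro ⟨Y, _, hY, hN, X, K, h₀, rfl, h⟩
    refine ⟨fun i => if i < n then X i else Y, fun i => if i ≤ n then K i else N,
      by simpa using h₀, by simp, fun i hi => ?_⟩
    obtain hi' | rfl : i < n ∨ i = n := by omega
    · simpa [hi', hi'.le, Nat.succ_le_of_lt hi'] using h i hi'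
    · simpa using ⟨hY, hN⟩

/-- Syzygies with respect to projective objects can be moved along inflations with Gorenstein
projective cokernel. -/
lemma HasResolution.exists_of_hasConflation {n : ℕ} {K L K' G : C}
    (h : T.HasResolution T.IsProjective n K L) (hK : T.HasConflation K K' G)
    (hG : T.IsGorensteinProjective G) :
    ∃ L' G' : C, T.HasResolution T.IsProjective n K' L' ∧ T.HasConflation L L' G' ∧
      T.IsGorensteinProjective G' := by
  induction n generalizing K K' G with
  | zero =>
    obtain rfl := hasResolution_zero_iff.1 h
    exact ⟨K', G, hasResolution_zero_iff.2 rfl, hK, hG⟩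
  | succ n ih =>
    obtain ⟨P, K₁, hP, hPK, h⟩ := hasResolution_succ_iff.1 h
    obtain ⟨H, hPH, hKH⟩ := hPK.exists_pushout hK
    -- `P ⟶ H ⟶ G` splits because `E(G, P) = 0`; exchanging the summands gives `G ⟶ H ⟶ P`.
    obtain ⟨b⟩ := hPH.nonempty_iso_biprod (hG.ext_eq_zero hP)
    have hGH : T.HasConflation G H P := ((T.realizes_inr_fst G P).of_iso b).hasConflation
    -- Pushing `H` out along `G ⟶ Q` embeds it in `R`, an extension of `P` by `Q` and so projective,
    -- with cokernel `G₁`.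
    obtain ⟨Q, G₁, hQ, hG₁, hGQ⟩ := hG.exists_hasConflation
    obtain ⟨R, hHR, hQR⟩ := hGH.exists_pushout hGQ
    -- The composite `K' ⟶ H ⟶ R` gives the new projective step; `K₁ ⟶ K₁' ⟶ G₁` is the input for
    -- the induction.
    obtain ⟨K₁', hKR, hKK⟩ := hKH.exists_comp hHR
    obtain ⟨L', G', hL', hLL', hG'⟩ := ih h hKK hG₁
    exact ⟨L', G', hasResolution_succ_iff.2 ⟨R, K₁', hQ.of_hasConflation hP hQR, hKR, hL'⟩,
      hLL', hG'⟩

/-- Every Gorenstein `n`-syzygy object, `n > 0`, is an `n`-syzygy object of an object that has a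
deflation onto a Gorenstein projective object. -/
lemma HasResolution.exists_isProjective {n : ℕ} {N M : C}
    (h : T.HasResolution T.IsGorensteinProjective n N M) :
    ∃ L : C, T.HasResolution T.IsProjective n N L ∧
      (0 < n → ∃ M' G : C, T.HasConflation M' L G ∧ T.IsGorensteinProjective G) := by
  induction n generalizing N with
  | zero => exact ⟨M, hasResolution_zero_iff.2 (hasResolution_zero_iff.1 h), by simp⟩
  | succ n ih =>
    obtain ⟨X, K, hX, hN, h⟩ := hasResolution_succ_iff.1 h
    obtain ⟨L, hL, -⟩ := ih h
    obtain ⟨P, G, hP, hG, hXP⟩ := hX.exists_hasConflation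
    obtain ⟨K', hNP, hKK⟩ := hN.exists_comp hXP
    obtain ⟨L', G', hL', hLL', hG'⟩ := hL.exists_of_hasConflation hKK hG
    exact ⟨L', hasResolution_succ_iff.2 ⟨P, K', hP, hNP, hL'⟩, fun _ => ⟨L, G', hLL', hG'⟩⟩

end Syzygies

end ExtriangulatedStructure

theorem theorem3p9 {C : Type u} [Category.{v} C] [Preadditive C] [HasZeroObject C] [HasBinaryBiproducts C]
    (T : ExtriangulatedStructure.{w} C) (hT : T.WIC) (n : ℕ) (hn : 1 ≤ n) (N : C) :
    (∃ M : C, T.IsGorensteinSyzygy n N M) ↔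
      ∃ (L G : C) (p : L ⟶ G), T.IsDeflation p ∧ T.IsSyzygy n N L ∧
        T.IsGorensteinProjective G := by
  constructor
  · rintro ⟨M, h⟩
    obtain ⟨L, hL, hG⟩ := (ExtriangulatedStructure.hasResolution_iff.2 h).exists_isProjective
    obtain ⟨M', G, ⟨x, p, hp⟩, hG⟩ := hG hn
    exact ⟨L, G, p, ⟨M', x, hp⟩, ExtriangulatedStructure.hasResolution_iff.1 hL, hG⟩
  · rintro ⟨L, -, -, -, ⟨S, hS⟩, -⟩
    exact ⟨L, S, fun i => ExtriangulatedStructure.IsProjective.isGorensteinProjective (hS i)⟩
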